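/- A link is a nonempty finite union of disjoint smoothly embedded circles in $\mathbb{R}^3$, considered up to ambient isotopy. A regular diagram $D$ of a link $L$ is given by a link ambient isotopic to $L$ whose projection to the plane is an immersed curve with only finitely many multiple points, all of them transverse double points (crossings), together with the over/under information at each crossing; the arcs of $D$ are the connected components obtained by cutting the link at the under points of the crossings. A $\mathbb{Z}$-coloring of $D$ is a map $\gamma:\{\text{arcs of }D\}\to\mathbb{Z}$ with $2\gamma(a)=\gamma(b)+\gamma(c)$ at each crossing with over arc $a$ and under arcs $b$ and $c$; it is trivial if it is constant. A link is $\mathbb{Z}$-colorable if some diagram of it admits a non-trivial $\mathbb{Z}$-coloring, and then $\mathrm{mincol}_{\mathbb{Z}}(L)$ denotes the minimum of the cardinalities of the images of all non-trivial $\mathbb{Z}$-colorings on all diagrams of $L$. **Theorem.** Let $L$ be a $\mathbb{Z}$-colorable link with $\mathrm{mincol}_{\mathbb{Z}}(L)=4$. Then there exist a diagram $D$ of $L$ and a $\mathbb{Z}$-coloring $\gamma$ on $D$ such that $\operatorname{Im}(\gamma)=\{0,1,2,3\}$. -/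

import Mathlib

open scoped ContDiff Topology

/-- Euclidean three-space. -/
abbrev E3 : Type := EuclideanSpace ℝ (Fin 3)

/-- The projection of three-space to the plane of the diagram, forgetting the height `x 2`. -/
def planeProj (x : E3) : EuclideanSpace ℝ (Fin 2) := !₂[x 0, x 1]

/-- A (smooth) link in three-space: a nonempty finite family of disjoint, smoothly embedded circles.
The circles are `ℝ / ℤ`, that is, each component is parametrized with period one. -/
structure Link where
  /-- the number of components -/
  numComp : ℕ
  numComp_pos : 0 < numComp
  /-- the parametrizations of the components -/
  param : Fin numComp → ℝ → E3
  smooth : ∀ i, ContDiff ℝ ∞ (param i)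
  periodic : ∀ i, Function.Periodic (param i) 1
  immersion : ∀ i t, deriv (param i) t ≠ 0
  injective : ∀ i j s t, param i s = param j t → i = j ∧ ∃ k : ℤ, t = s + k

namespace Link

/-- The underlying set of points of a link. -/
def carrier (L : Link) : Set E3 := {p | ∃ i t, L.param i t = p}

/-- Two links are equivalent if a smooth ambient isotopy of three-space carries the underlying set
of the first to that of the second. -/
def Equivalent (L K : Link) : Prop :=
  ∃ Φ : ℝ → (E3 ≃ₜ E3),
    ContDiff ℝ ∞ (fun q : ℝ × E3 => Φ q.1 q.2) ∧
    (∀ t, ContDiff ℝ ∞ (Φ t).symm) ∧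
    (∀ x, Φ 0 x = x) ∧
    Φ 1 '' L.carrier = K.carrier

end Link

/-- A regular diagram: a link in general position with respect to the projection to the plane. The
projection of the link is an immersed curve with finitely many multiple points, all of which are
transverse double points; the heights of the two points over a double point tell the over strand from the under strand. -/
structure LinkDiagram extends Link where
  proj_immersion : ∀ i t, planeProj (deriv (param i) t) ≠ 0
  finite_multiple_points : {z | ∃ p q : E3, p ∈ toLink.carrier ∧ q ∈ toLink.carrier ∧ p ≠ q ∧
    planeProj p = z ∧ planeProj q = z}.Finite
  no_triple_points : ∀ p q r : E3,
    p ∈ toLink.carrier → q ∈ toLink.carrier → r ∈ toLink.carrier →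
    planeProj p = planeProj q → planeProj q = planeProj r → p = q ∨ q = r ∨ p = r
  transverse : ∀ i j s t, param i s ≠ param j t →
    planeProj (param i s) = planeProj (param j t) →
    LinearIndependent ℝ ![planeProj (deriv (param i) s), planeProj (deriv (param j) t)]

namespace LinkDiagram

/-- There is a crossing with over point `p` and under point `q`. -/
def IsCrossing (D : LinkDiagram) (p q : E3) : Prop :=
  p ∈ D.carrier ∧ q ∈ D.carrier ∧ planeProj p = planeProj q ∧ q 2 < p 2

/-- The link with the under points of all crossings removed. -/
def cutCarrier (D : LinkDiagram) : Set E3 :=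
  {q | q ∈ D.carrier ∧ ∀ p, ¬ D.IsCrossing p q}

/-- The arcs of a diagram: the connected components of what is left of the link when it is cut at
all under points. -/
def Arc (D : LinkDiagram) : Type :=
  {A : Set E3 // ∃ p ∈ D.cutCarrier, A = connectedComponentIn D.cutCarrier p}

/-- There is a crossing with over arc `a` and with the under arcs `b` and `c`: the over point lies
on `a`, and a strand running through the under point comes in along `b` and leaves along `c`. -/
def ArcsAtCrossing (D : LinkDiagram) (a b c : D.Arc) : Prop :=
  ∃ (p : E3) (i : Fin D.numComp) (t : ℝ), D.IsCrossing p (D.param i t) ∧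
    p ∈ a.1 ∧
    (∀ᶠ u in 𝓝[<] t, D.param i u ∈ b.1) ∧
    (∀ᶠ u in 𝓝[>] t, D.param i u ∈ c.1)

/-- A `ℤ`-coloring of a diagram. -/
def IsZColoring (D : LinkDiagram) (γ : D.Arc → ℤ) : Prop :=
  ∀ a b c : D.Arc, D.ArcsAtCrossing a b c → 2 * γ a = γ b + γ c

/-- The coloring assigns the same color to all the arcs. -/
def IsTrivialColoring (D : LinkDiagram) (γ : D.Arc → ℤ) : Prop :=
  ∃ m : ℤ, ∀ a, γ a = m

end LinkDiagram

namespace Link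

/-- `D` is a diagram of the link `L`. -/
def HasDiagram (L : Link) (D : LinkDiagram) : Prop := L.Equivalent D.toLink

/-- Some diagram of the link admits a non-trivial `ℤ`-coloring. -/
def IsZColorable (L : Link) : Prop :=
  ∃ D : LinkDiagram, L.HasDiagram D ∧
    ∃ γ : D.Arc → ℤ, D.IsZColoring γ ∧ ¬ D.IsTrivialColoring γ

/-- The minimal coloring number: the minimum of the numbers of colors of the non-trivial
`ℤ`-colorings of the diagrams of the link (and `⊤` if there is no such coloring). -/
noncomputable def mincolZ (L : Link) : ℕ∞ :=
  sInf {n : ℕ∞ | ∃ D : LinkDiagram, L.HasDiagram D ∧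
    ∃ γ : D.Arc → ℤ, D.IsZColoring γ ∧ ¬ D.IsTrivialColoring γ ∧ (Set.range γ).encard = n}

end Link

/-! Take a diagram and a coloring with exactly four colors, and suppose some color `v` is not an end
of a nontrivial three-term progression of colors. The crossing relation then carries `v` through
every under point, so `v` fills whole components (`color_const_on_component`), and any strand over
such a component also has color `v` (`color_over_eq`). Hence the `v`-components lie above all the
others and can be slid off them horizontally (`exists_separated`). The resulting split diagram has a
coloring by 0 and 1, so `mincolZ` is at most 2, a contradiction.

So each of the four colors is an end of such a progression, which makes the colors equally spaced
(`exists_eq_arithmetic_progression`). An affine change of colors turns them into 0, 1, 2, 3 on the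
same diagram. -/

theorem E3.ext_of_planeProj {p q : E3} (h : planeProj p = planeProj q) (h2 : p 2 = q 2) :
    p = q := by
  have h0 := congrArg (fun x : EuclideanSpace ℝ (Fin 2) => x 0) h
  have h1 := congrArg (fun x : EuclideanSpace ℝ (Fin 2) => x 1) h
  simp only [planeProj, PiLp.toLp_apply, Matrix.cons_val_zero, Matrix.cons_val_one] at h0 h1
  ext i
  fin_cases i
  · exact h0
  · exact h1
  · exact h2

/-! ### Arcs near a parameter of the link -/

namespace Link

theorem continuous_param (L : Link) (i : Fin L.numComp) : Continuous (L.param i) :=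
  (L.smooth i).continuous

theorem param_mem_carrier (L : Link) (i : Fin L.numComp) (t : ℝ) : L.param i t ∈ L.carrier :=
  ⟨i, t, rfl⟩

theorem eventually_param_ne (L : Link) (i : Fin L.numComp) (t : ℝ) (q : E3) :
    ∀ᶠ u in 𝓝[≠] t, L.param i u ≠ q := by
  by_cases hq : L.param i t = q
  · have h1 : ∀ᶠ u in 𝓝[≠] t, u ∈ Metric.ball t 1 :=
      nhdsWithin_le_nhds (Metric.ball_mem_nhds t one_pos)
    filter_upwards [h1, self_mem_nhdsWithin] with u hu hne heq
    obtain ⟨-, k, hk⟩ := L.injective i i t u (hq.trans heq.symm)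
    rw [Metric.mem_ball, Real.dist_eq, hk, add_sub_cancel_left] at hu
    have hk0 : k = 0 := by
      rw [← Int.cast_abs] at hu
      have : |k| < 1 := by exact_mod_cast hu
      exact Int.abs_lt_one_iff.1 this
    exact hne (by simp [hk, hk0])
  · exact nhdsWithin_le_nhds ((L.continuous_param i).continuousAt.eventually_ne hq)

end Link

namespace LinkDiagram

theorem IsCrossing.ne {D : LinkDiagram} {p q : E3} (h : D.IsCrossing p q) : p ≠ q := by
  rintro rfl
  exact lt_irrefl _ h.2.2.2

/-- A strand above `p` would create a triple point. Thus an over point always lies on an arc and has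
a color. -/
theorem IsCrossing.over_mem_cutCarrier {D : LinkDiagram} {p q : E3} (h : D.IsCrossing p q) :
    p ∈ D.cutCarrier := by
  refine ⟨h.1, fun r hr => ?_⟩
  rcases D.no_triple_points r p q hr.1 h.1 h.2.1 hr.2.2.1 h.2.2.1 with e | e | e
  · exact hr.ne e
  · exact h.ne e
  · have h1 := hr.2.2.2
    have h2 := h.2.2.2
    rw [e] at h1
    exact lt_asymm h1 h2

/-- A diagram has finitely many under points. -/
theorem finite_underPoints (D : LinkDiagram) : {q | ∃ p, D.IsCrossing p q}.Finite := by
  -- `planeProj` is injective on under points: each double point has only one.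
  refine Set.Finite.of_finite_image (f := planeProj) (D.finite_multiple_points.subset ?_) ?_
  · rintro _ ⟨q, ⟨p, h⟩, rfl⟩
    exact ⟨p, q, h.1, h.2.1, h.ne, h.2.2.1, rfl⟩
  · rintro q ⟨p, h⟩ q' ⟨p', h'⟩ e
    rcases D.no_triple_points p q q' h.1 h.2.1 h'.2.1 h.2.2.1 e with e1 | e1 | e1
    · exact (h.ne e1).elim
    · exact e1
    · exact (h.over_mem_cutCarrier.2 p' (e1 ▸ h')).elim

theorem eventually_mem_cutCarrier (D : LinkDiagram) (i : Fin D.numComp) (t : ℝ) :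
    ∀ᶠ u in 𝓝[≠] t, D.param i u ∈ D.cutCarrier := by
  have h := (Filter.eventually_all_finite D.finite_underPoints).2
    fun q _ => D.eventually_param_ne i t q
  filter_upwards [h] with u hu
  exact ⟨D.param_mem_carrier i u, fun p hp => hu _ ⟨p, hp⟩ rfl⟩

/-- The arc through a point of the cut link. -/
def arcOf (D : LinkDiagram) {p : E3} (hp : p ∈ D.cutCarrier) : D.Arc :=
  ⟨connectedComponentIn D.cutCarrier p, p, hp, rfl⟩

theorem mem_arcOf (D : LinkDiagram) {p : E3} (hp : p ∈ D.cutCarrier) : p ∈ (D.arcOf hp).1 :=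
  mem_connectedComponentIn hp

namespace Arc

variable {D : LinkDiagram}

theorem subset_cutCarrier (A : D.Arc) : A.1 ⊆ D.cutCarrier := by
  obtain ⟨A, p, hp, rfl⟩ := A
  exact connectedComponentIn_subset _ _

theorem nonempty (A : D.Arc) : A.1.Nonempty := by
  obtain ⟨A, p, hp, rfl⟩ := A
  exact ⟨p, mem_connectedComponentIn hp⟩

theorem isPreconnected (A : D.Arc) : IsPreconnected A.1 := by
  obtain ⟨A, p, hp, rfl⟩ := A
  exact isPreconnected_connectedComponentIn

theorem eq_of_mem {A B : D.Arc} {p : E3} (hA : p ∈ A.1) (hB : p ∈ B.1) : A = B := by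
  obtain ⟨A, a, ha, rfl⟩ := A
  obtain ⟨B, b, hb, rfl⟩ := B
  exact Subtype.ext ((connectedComponentIn_eq hA).trans (connectedComponentIn_eq hB).symm)

end Arc

theorem exists_arc_of_Ioo (D : LinkDiagram) (i : Fin D.numComp) {a b : ℝ} (hab : a < b)
    (h : ∀ u ∈ Set.Ioo a b, D.param i u ∈ D.cutCarrier) :
    ∃ A : D.Arc, ∀ u ∈ Set.Ioo a b, D.param i u ∈ A.1 := by
  obtain ⟨m, hm⟩ := exists_between hab
  refine ⟨D.arcOf (h m hm), fun u hu => ?_⟩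
  have hp : IsPreconnected (D.param i '' Set.Ioo a b) :=
    isPreconnected_Ioo.image _ (D.continuous_param i).continuousOn
  exact hp.subset_connectedComponentIn (Set.mem_image_of_mem _ hm)
    (by rintro _ ⟨w, hw, rfl⟩; exact h w hw) (Set.mem_image_of_mem _ hu)

theorem exists_arc_left (D : LinkDiagram) (i : Fin D.numComp) (t : ℝ) :
    ∃ A : D.Arc, ∀ᶠ u in 𝓝[<] t, D.param i u ∈ A.1 := by
  have h : ∀ᶠ u in 𝓝[<] t, D.param i u ∈ D.cutCarrier :=
    nhdsWithin_mono t (fun u (hu : u < t) => hu.ne) (D.eventually_mem_cutCarrier i t)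
  obtain ⟨a, ha, hs⟩ := mem_nhdsLT_iff_exists_Ioo_subset.1 h
  obtain ⟨A, hA⟩ := D.exists_arc_of_Ioo i ha hs
  exact ⟨A, Filter.mem_of_superset (Ioo_mem_nhdsLT ha) hA⟩

theorem exists_arc_right (D : LinkDiagram) (i : Fin D.numComp) (t : ℝ) :
    ∃ A : D.Arc, ∀ᶠ u in 𝓝[>] t, D.param i u ∈ A.1 := by
  have h : ∀ᶠ u in 𝓝[>] t, D.param i u ∈ D.cutCarrier :=
    nhdsWithin_mono t (fun u (hu : t < u) => hu.ne') (D.eventually_mem_cutCarrier i t)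
  obtain ⟨a, ha, hs⟩ := mem_nhdsGT_iff_exists_Ioo_subset.1 h
  obtain ⟨A, hA⟩ := D.exists_arc_of_Ioo i ha hs
  exact ⟨A, Filter.mem_of_superset (Ioo_mem_nhdsGT ha) hA⟩

/-- An arc at `t` when `param i t` is not an under point. -/
theorem exists_arc_nhds (D : LinkDiagram) (i : Fin D.numComp) {t : ℝ}
    (ht : D.param i t ∈ D.cutCarrier) :
    ∃ A : D.Arc, D.param i t ∈ A.1 ∧ ∀ᶠ u in 𝓝 t, D.param i u ∈ A.1 := by
  have h : ∀ᶠ u in 𝓝 t, D.param i u ∈ D.cutCarrier := by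
    have h1 := eventually_nhdsWithin_iff.1 (D.eventually_mem_cutCarrier i t)
    filter_upwards [h1] with u hu
    by_cases e : u = t
    · rwa [e]
    · exact hu e
  obtain ⟨a, b, hab, hs⟩ := mem_nhds_iff_exists_Ioo_subset.1 h
  obtain ⟨A, hA⟩ := D.exists_arc_of_Ioo i (hab.1.trans hab.2) hs
  exact ⟨A, hA t hab, Filter.mem_of_superset (Ioo_mem_nhds hab.1 hab.2) hA⟩

/-! ### Propagation of an isolated color along components -/

/-- If the color `v` is not an end of a nontrivial three-term arithmetic progression of colors,
then near every parameter either all the arcs have color `v` or none of them has. -/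
theorem eventually_color_iff (D : LinkDiagram) {γ : D.Arc → ℤ} (hγ : D.IsZColoring γ) {v : ℤ}
    (hv : ∀ a b, 2 * γ a = v + γ b → γ b = v) (i : Fin D.numComp) (t : ℝ) :
    (∀ᶠ u in 𝓝 t, ∀ A : D.Arc, D.param i u ∈ A.1 → γ A = v) ∨
      (∀ᶠ u in 𝓝 t, ∀ A : D.Arc, D.param i u ∈ A.1 → γ A ≠ v) := by
  by_cases ht : D.param i t ∈ D.cutCarrier
  · obtain ⟨A, -, hA⟩ := D.exists_arc_nhds i ht
    by_cases e : γ A = v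
    · left
      filter_upwards [hA] with u hu B hB
      rw [Arc.eq_of_mem hB hu, e]
    · right
      filter_upwards [hA] with u hu B hB
      rwa [Arc.eq_of_mem hB hu]
  · have hx : ∃ p, D.IsCrossing p (D.param i t) := by
      by_contra hn
      exact ht ⟨D.param_mem_carrier i t, not_exists.1 hn⟩
    obtain ⟨p, hp⟩ := hx
    obtain ⟨b, hb⟩ := D.exists_arc_left i t
    obtain ⟨c, hc⟩ := D.exists_arc_right i t
    have hcol := hγ (D.arcOf hp.over_mem_cutCarrier) b c
      ⟨p, i, t, hp, D.mem_arcOf _, hb, hc⟩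
    -- If one under arc has color `v`, the crossing relation makes `v`, the over color and the other
    -- under color a progression, which `hv` forces to be constant.
    have hbc : γ b = v ↔ γ c = v := by
      constructor
      · intro e
        exact hv _ c (by rw [hcol, e])
      · intro e
        exact hv _ b (by rw [hcol, e, add_comm])
    have key : ∀ᶠ u in 𝓝 t, ∀ A : D.Arc, D.param i u ∈ A.1 → (γ A = v ↔ γ b = v) := by
      have h1 := eventually_nhdsWithin_iff.1 hb
      have h2 := eventually_nhdsWithin_iff.1 hc
      filter_upwards [h1, h2] with u h1 h2 A hA
      rcases lt_trichotomy u t with h | h | h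
      · rw [Arc.eq_of_mem hA (h1 h)]
      · rw [h] at hA
        exact (ht (A.subset_cutCarrier hA)).elim
      · rw [Arc.eq_of_mem hA (h2 h), hbc]
    by_cases e : γ b = v
    · left
      filter_upwards [key] with u hu A hA using (hu A hA).2 e
    · right
      filter_upwards [key] with u hu A hA using fun h => e ((hu A hA).1 h)

/-- If the color `v` is not an end of a nontrivial three-term arithmetic progression of colors,
then on every component either all the arcs have color `v` or none of them has. -/
theorem color_const_on_component (D : LinkDiagram) {γ : D.Arc → ℤ} (hγ : D.IsZColoring γ) {v : ℤ}
    (hv : ∀ a b, 2 * γ a = v + γ b → γ b = v) (i : Fin D.numComp) :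
    (∀ t, ∀ A : D.Arc, D.param i t ∈ A.1 → γ A = v) ∨
      (∀ t, ∀ A : D.Arc, D.param i t ∈ A.1 → γ A ≠ v) := by
  set U : Set ℝ := {t | ∀ᶠ u in 𝓝 t, ∀ A : D.Arc, D.param i u ∈ A.1 → γ A = v}
  set V : Set ℝ := {t | ∀ᶠ u in 𝓝 t, ∀ A : D.Arc, D.param i u ∈ A.1 → γ A ≠ v}
  have hU : IsOpen U := isOpen_setOfPred_eventually_nhds
  have hV : IsOpen V := isOpen_setOfPred_eventually_nhds
  have hUV : Set.univ ⊆ U ∪ V := fun t _ => D.eventually_color_iff hγ hv i t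
  have hdisj : Disjoint U V := by
    rw [Set.disjoint_left]
    intro t h1 h2
    -- At an under point both color conditions are vacuous, so they are compared at nearby
    -- parameters, which do lie on arcs.
    have h3 : ∀ᶠ u in 𝓝[≠] t, False := by
      filter_upwards [nhdsWithin_le_nhds h1, nhdsWithin_le_nhds h2,
        D.eventually_mem_cutCarrier i t] with u h1 h2 h3
      exact h2 _ (D.mem_arcOf h3) (h1 _ (D.mem_arcOf h3))
    exact h3.exists.choose_spec
  rcases isPreconnected_univ.subset_or_subset hU hV hdisj hUV with h | h
  · exact Or.inl fun t => Filter.Eventually.self_of_nhds (h (Set.mem_univ t))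
  · exact Or.inr fun t => Filter.Eventually.self_of_nhds (h (Set.mem_univ t))

/-- If the color `v` is not an end of a nontrivial three-term arithmetic progression of colors,
then the over points of the crossings above a component of color `v` have color `v`. -/
theorem color_over_eq (D : LinkDiagram) {γ : D.Arc → ℤ} (hγ : D.IsZColoring γ) {v : ℤ}
    (hv : ∀ a b, 2 * γ a = v + γ b → γ b = v) {i : Fin D.numComp}
    (hi : ∀ t, ∀ A : D.Arc, D.param i t ∈ A.1 → γ A = v) {p : E3} {t : ℝ}
    (hp : D.IsCrossing p (D.param i t)) : γ (D.arcOf hp.over_mem_cutCarrier) = v := by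
  obtain ⟨b, hb⟩ := D.exists_arc_left i t
  obtain ⟨c, hc⟩ := D.exists_arc_right i t
  have hcol := hγ (D.arcOf hp.over_mem_cutCarrier) b c ⟨p, i, t, hp, D.mem_arcOf _, hb, hc⟩
  obtain ⟨u, hu⟩ := hb.exists
  have hbv := hi u b hu
  have hcv := hv _ c (by rw [hcol, hbv])
  omega

end LinkDiagram

/-! ### Moving an upper compact set aside by shears -/

theorem contDiff_planeProj {n : WithTop ℕ∞} : ContDiff ℝ n planeProj := by
  rw [contDiff_euclidean]
  intro i
  fin_cases i
  · exact contDiff_euclidean.1 contDiff_id (0 : Fin 3)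
  · exact contDiff_euclidean.1 contDiff_id (1 : Fin 3)

theorem continuous_planeProj : Continuous planeProj :=
  (contDiff_planeProj (n := 0)).continuous

/-- The projection to the plane as a continuous linear map. -/
noncomputable def planeProjL : E3 →L[ℝ] EuclideanSpace ℝ (Fin 2) :=
  LinearMap.toContinuousLinearMap
    { toFun := planeProj
      map_add' := fun x y => by ext i; fin_cases i <;> simp [planeProj]
      map_smul' := fun c x => by ext i; fin_cases i <;> simp [planeProj] }

theorem planeProj_deriv {f : ℝ → E3} {t : ℝ} (hf : DifferentiableAt ℝ f t) :
    planeProj (deriv f t) = deriv (fun u => planeProj (f u)) t :=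
  (planeProjL.hasFDerivAt.comp_hasDerivAt t hf.hasDerivAt).deriv.symm

/-- Two compact sets of reals, one below the other, are separated by a number. -/
theorem exists_between_of_isCompact {A B : Set ℝ} (hA : IsCompact A) (hB : IsCompact B)
    (h : ∀ a ∈ A, ∀ b ∈ B, a < b) : ∃ c, (∀ a ∈ A, a < c) ∧ ∀ b ∈ B, c < b := by
  rcases A.eq_empty_or_nonempty with rfl | hAn
  · obtain ⟨m, hm⟩ := hB.bddBelow
    exact ⟨m - 1, by simp, fun b hb => by linarith [hm hb]⟩
  rcases B.eq_empty_or_nonempty with rfl | hBn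
  · obtain ⟨m, hm⟩ := hA.bddAbove
    exact ⟨m + 1, fun a ha => by linarith [hm ha], by simp⟩
  obtain ⟨c, h1, h2⟩ := exists_between (h _ (hA.sSup_mem hAn) _ (hB.sInf_mem hBn))
  exact ⟨c, fun a ha => (le_csSup hA.bddAbove ha).trans_lt h1,
    fun b hb => h2.trans_le (csInf_le hB.bddBelow hb)⟩

theorem continuous_height : Continuous fun p : E3 => p 2 := by fun_prop

/-- If a compact set lies above another one, they are separated by the graph of a smooth function
on the plane. -/
theorem exists_contDiff_separating {R T : Set E3} (hR : IsCompact R) (hT : IsCompact T)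
    (h : ∀ p ∈ R, ∀ q ∈ T, planeProj p = planeProj q → p 2 < q 2) :
    ∃ s : EuclideanSpace ℝ (Fin 2) → ℝ, ContDiff ℝ ∞ s ∧
      (∀ p ∈ R, p 2 < s (planeProj p)) ∧ ∀ q ∈ T, s (planeProj q) < q 2 := by
  -- The admissible heights over `y` form a convex set, so locally constant choices can be glued
  -- smoothly by a partition of unity.
  let S : EuclideanSpace ℝ (Fin 2) → Set ℝ := fun y =>
    {r | (∀ p ∈ R, planeProj p = y → p 2 < r) ∧ ∀ q ∈ T, planeProj q = y → r < q 2}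
  have hconv : ∀ y, Convex ℝ (S y) := by
    intro y
    apply Set.OrdConnected.convex
    constructor
    intro a ha b hb c hc
    exact ⟨fun p hp e => (ha.1 p hp e).trans_le hc.1, fun q hq e => hc.2.trans_lt (hb.2 q hq e)⟩
  have hfib : ∀ (K : Set E3), IsCompact K → ∀ y,
      IsCompact ((fun p : E3 => p 2) '' (K ∩ planeProj ⁻¹' {y})) := fun K hK y =>
    (hK.inter_right (isClosed_singleton.preimage continuous_planeProj)).image continuous_height
  have hloc : ∀ y, ∃ c, ∀ᶠ y' in 𝓝 y, c ∈ S y' := by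
    intro y
    obtain ⟨c, h1, h2⟩ := exists_between_of_isCompact (hfib R hR y) (hfib T hT y) (by
      rintro _ ⟨p, ⟨hp, ep⟩, rfl⟩ _ ⟨q, ⟨hq, eq⟩, rfl⟩
      exact h p hp q hq (Eq.trans ep (Eq.symm eq)))
    refine ⟨c, ?_⟩
    -- The plane points where the height `c` fails are projections of compact sets, so `c` remains
    -- admissible near `y`.
    have k1 : IsClosed (planeProj '' (R ∩ {p | c ≤ p 2})) :=
      ((hR.inter_right (isClosed_le continuous_const continuous_height)).image
        continuous_planeProj).isClosed
    have k2 : IsClosed (planeProj '' (T ∩ {p | p 2 ≤ c})) :=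
      ((hT.inter_right (isClosed_le continuous_height continuous_const)).image
        continuous_planeProj).isClosed
    have m1 : y ∉ planeProj '' (R ∩ {p | c ≤ p 2}) := by
      rintro ⟨p, ⟨hp, hc⟩, e⟩
      exact absurd (h1 _ ⟨p, ⟨hp, e⟩, rfl⟩) (not_lt.2 hc)
    have m2 : y ∉ planeProj '' (T ∩ {p | p 2 ≤ c}) := by
      rintro ⟨p, ⟨hp, hc⟩, e⟩
      exact absurd (h2 _ ⟨p, ⟨hp, e⟩, rfl⟩) (not_lt.2 hc)
    filter_upwards [k1.isOpen_compl.mem_nhds m1, k2.isOpen_compl.mem_nhds m2] with y' n1 n2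
    constructor
    · intro p hp e
      by_contra hc
      exact n1 ⟨p, ⟨hp, not_lt.1 hc⟩, e⟩
    · intro q hq e
      by_contra hc
      exact n2 ⟨q, ⟨hq, not_lt.1 hc⟩, e⟩
  obtain ⟨g, hg⟩ := exists_contMDiffMap_forall_mem_convex_of_local_const
    (n := (⊤ : ℕ∞)) (modelWithCornersSelf ℝ (EuclideanSpace ℝ (Fin 2))) hconv hloc
  exact ⟨g, contMDiff_iff_contDiff.1 g.contMDiff, fun p hp => (hg _).1 p hp rfl,
    fun q hq => (hg _).2 q hq rfl⟩

/-- The vertical shear along the function `s`, followed by the horizontal shear along `c`. -/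
noncomputable def doubleShear (s : EuclideanSpace ℝ (Fin 2) → ℝ) (c : ℝ → ℝ) (x : E3) : E3 :=
  !₂[x 0 + c (x 2 - s (planeProj x)), x 1, x 2 - s (planeProj x)]

/-- The inverse of `doubleShear`. -/
noncomputable def doubleShearInv (s : EuclideanSpace ℝ (Fin 2) → ℝ) (c : ℝ → ℝ) (x : E3) : E3 :=
  !₂[x 0 - c (x 2), x 1, x 2 + s !₂[x 0 - c (x 2), x 1]]

theorem doubleShearInv_doubleShear (s : EuclideanSpace ℝ (Fin 2) → ℝ) (c : ℝ → ℝ) (x : E3) :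
    doubleShearInv s c (doubleShear s c x) = x := by
  ext i
  fin_cases i <;> simp [doubleShear, doubleShearInv, planeProj]

theorem doubleShear_doubleShearInv (s : EuclideanSpace ℝ (Fin 2) → ℝ) (c : ℝ → ℝ) (x : E3) :
    doubleShear s c (doubleShearInv s c x) = x := by
  ext i
  fin_cases i <;> simp [doubleShear, doubleShearInv, planeProj]

theorem contDiff_doubleShear_smul {s : EuclideanSpace ℝ (Fin 2) → ℝ} {c : ℝ → ℝ}
    (hs : ContDiff ℝ ∞ s) (hc : ContDiff ℝ ∞ c) :
    ContDiff ℝ ∞ fun q : ℝ × E3 =>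
      doubleShear (fun y => q.1 * s y) (fun z => q.1 * c z) q.2 := by
  have hx : ∀ i : Fin 3, ContDiff ℝ ∞ fun q : ℝ × E3 => q.2 i :=
    contDiff_euclidean.1 contDiff_snd
  have hz : ContDiff ℝ ∞ fun q : ℝ × E3 => q.2 2 - q.1 * s (planeProj q.2) :=
    (hx 2).sub (contDiff_fst.mul (hs.comp (contDiff_planeProj.comp contDiff_snd)))
  rw [contDiff_euclidean]
  intro i
  fin_cases i
  · exact (hx 0).add (contDiff_fst.mul (hc.comp hz))
  · exact hx 1
  · exact hz

theorem contDiff_doubleShearInv {s : EuclideanSpace ℝ (Fin 2) → ℝ} {c : ℝ → ℝ}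
    (hs : ContDiff ℝ ∞ s) (hc : ContDiff ℝ ∞ c) : ContDiff ℝ ∞ (doubleShearInv s c) := by
  have hx : ∀ i : Fin 3, ContDiff ℝ ∞ fun q : E3 => q i := contDiff_euclidean.1 contDiff_id
  have h0 : ContDiff ℝ ∞ fun q : E3 => q 0 - c (q 2) := (hx 0).sub (hc.comp (hx 2))
  have h01 : ContDiff ℝ ∞ fun q : E3 =>
      (!₂[q 0 - c (q 2), q 1] : EuclideanSpace ℝ (Fin 2)) := by
    rw [contDiff_euclidean]
    intro i
    fin_cases i
    · exact h0
    · exact hx 1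
  rw [contDiff_euclidean]
  intro i
  fin_cases i
  · exact h0
  · exact hx 1
  · exact (hx 2).add (hs.comp h01)

/-- The double shears by the multiples of `s` and `c` are homeomorphisms. -/
noncomputable def doubleShearHomeo {s : EuclideanSpace ℝ (Fin 2) → ℝ} {c : ℝ → ℝ}
    (hs : ContDiff ℝ ∞ s) (hc : ContDiff ℝ ∞ c) (t : ℝ) : E3 ≃ₜ E3 where
  toFun := doubleShear (fun y => t * s y) (fun z => t * c z)
  invFun := doubleShearInv (fun y => t * s y) (fun z => t * c z)
  left_inv := doubleShearInv_doubleShear _ _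
  right_inv := doubleShear_doubleShearInv _ _
  continuous_toFun := by
    have h := (contDiff_doubleShear_smul hs hc).continuous
    exact h.comp (Continuous.prodMk continuous_const continuous_id)
  continuous_invFun :=
    (contDiff_doubleShearInv (contDiff_const.mul hs) (contDiff_const.mul hc)).continuous

namespace Link

theorem equivalent_of_doubleShear {L K : Link} {s : EuclideanSpace ℝ (Fin 2) → ℝ} {c : ℝ → ℝ}
    (hs : ContDiff ℝ ∞ s) (hc : ContDiff ℝ ∞ c) (h : doubleShear s c '' L.carrier = K.carrier) :
    L.Equivalent K := by
  -- The isotopy scales both shears by the time `t`.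
  refine ⟨doubleShearHomeo hs hc, contDiff_doubleShear_smul hs hc, fun t =>
    contDiff_doubleShearInv (contDiff_const.mul hs) (contDiff_const.mul hc), fun x => ?_, ?_⟩
  · change doubleShear (fun y => 0 * s y) (fun z => 0 * c z) x = x
    ext i
    fin_cases i <;> simp [doubleShear]
  · change doubleShear (fun y => 1 * s y) (fun z => 1 * c z) '' L.carrier = K.carrier
    simpa only [one_mul] using h

theorem Equivalent.trans {L K M : Link} (h : L.Equivalent K) (h' : K.Equivalent M) :
    L.Equivalent M := by
  obtain ⟨Φ, h1, h2, h3, h4⟩ := h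
  obtain ⟨Ψ, k1, k2, k3, k4⟩ := h'
  refine ⟨fun t => (Φ t).trans (Ψ t), ?_, fun t => ?_, fun x => ?_, ?_⟩
  · exact k1.comp (contDiff_fst.prodMk h1)
  · exact (h2 t).comp (k2 t)
  · change Ψ 0 (Φ 0 x) = x
    rw [h3, k3]
  · change (fun x => Ψ 1 (Φ 1 x)) '' L.carrier = M.carrier
    rw [← Set.image_image (Ψ 1) (Φ 1), h4, k4]

end Link

/-- Two compact sets, one above the other, can be moved apart horizontally by a double shear. -/
theorem exists_doubleShear_separating {R T : Set E3} (hR : IsCompact R) (hT : IsCompact T)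
    (h : ∀ p ∈ R, ∀ q ∈ T, planeProj p = planeProj q → p 2 < q 2) :
    ∃ (s : EuclideanSpace ℝ (Fin 2) → ℝ) (c : ℝ → ℝ) (w : EuclideanSpace ℝ (Fin 2)),
      ContDiff ℝ ∞ s ∧ ContDiff ℝ ∞ c ∧
      (∀ p ∈ R, planeProj (doubleShear s c p) = planeProj p) ∧
      (∀ q ∈ T, planeProj (doubleShear s c q) = planeProj q + w) ∧
      ∀ p ∈ R, ∀ q ∈ T, planeProj (doubleShear s c p) ≠ planeProj (doubleShear s c q) := by
  obtain ⟨s, hs, hsR, hsT⟩ := exists_contDiff_separating hR hT h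
  have hcont : Continuous fun q : E3 => q 2 - s (planeProj q) :=
    continuous_height.sub (hs.continuous.comp continuous_planeProj)
  obtain ⟨ε, hε, hεT⟩ : ∃ ε > 0, ∀ q ∈ T, ε ≤ q 2 - s (planeProj q) := by
    obtain ⟨ε, h1, h2⟩ := exists_between_of_isCompact (isCompact_singleton (x := (0 : ℝ)))
      (hT.image hcont) (by
        rintro _ rfl _ ⟨q, hq, rfl⟩
        exact sub_pos.2 (hsT q hq))
    exact ⟨ε, h1 0 rfl, fun q hq => (h2 _ ⟨q, hq, rfl⟩).le⟩
  have hx : Continuous fun q : E3 => q 0 := by fun_prop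
  obtain ⟨a, ha⟩ := (hR.image hx).bddAbove
  obtain ⟨b, hb⟩ := (hT.image hx).bddBelow
  -- First coordinates are at most `a` on `R` and at least `b` on `T`; a shift by `N` brings those
  -- of `T` to at least `a + 1`.
  set N : ℝ := a - b + 1 with hN
  -- After the vertical shear, `R` has negative heights, where `c` is 0, and `T` has heights at
  -- least `ε`, where `c` is `N`.
  set c : ℝ → ℝ := fun z => N * Real.smoothTransition (z / ε) with hc
  have hcR : ∀ p ∈ R, c (p 2 - s (planeProj p)) = 0 := by
    intro p hp
    have : (p 2 - s (planeProj p)) / ε ≤ 0 :=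
      div_nonpos_of_nonpos_of_nonneg (sub_nonpos.2 (hsR p hp).le) hε.le
    simp [hc, Real.smoothTransition.zero_of_nonpos this]
  have hcT : ∀ q ∈ T, c (q 2 - s (planeProj q)) = N := by
    intro q hq
    have : 1 ≤ (q 2 - s (planeProj q)) / ε := (one_le_div hε).2 (hεT q hq)
    simp [hc, Real.smoothTransition.one_of_one_le this]
  have h1 : ∀ p ∈ R, planeProj (doubleShear s c p) = planeProj p := by
    intro p hp
    ext i
    fin_cases i <;> simp [planeProj, doubleShear]
    exact hcR p hp
  have h2 : ∀ q ∈ T, planeProj (doubleShear s c q) = planeProj q + !₂[N, 0] := by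
    intro q hq
    ext i
    fin_cases i <;> simp [planeProj, doubleShear]
    exact hcT q hq
  refine ⟨s, c, !₂[N, 0], hs, ?_, h1, h2, ?_⟩
  · exact contDiff_const.mul (Real.smoothTransition.contDiff.comp (contDiff_id.div_const ε))
  · intro p hp q hq e
    rw [h1 p hp, h2 q hq] at e
    have e0 := congrArg (fun x : EuclideanSpace ℝ (Fin 2) => x 0) e
    simp only [planeProj, PiLp.add_apply, PiLp.toLp_apply, Matrix.cons_val_zero] at e0
    have := ha ⟨p, hp, rfl⟩
    have := hb ⟨q, hq, rfl⟩
    simp only at *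
    linarith

/-! ### Sublinks, split diagrams and two-colorings -/

namespace Link

/-- The union of the components with indices in `I`. -/
def subCarrier (L : Link) (I : Set (Fin L.numComp)) : Set E3 :=
  {p | ∃ i ∈ I, ∃ t, L.param i t = p}

theorem isCompact_subCarrier (L : Link) (I : Set (Fin L.numComp)) :
    IsCompact (L.subCarrier I) := by
  have h : L.subCarrier I = ⋃ i ∈ I, Set.range (L.param i) := by
    ext p
    simp [subCarrier]
  rw [h]
  exact I.toFinite.isCompact_biUnion fun i _ =>
    (L.periodic i).compact_of_continuous one_ne_zero (L.continuous_param i)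

theorem param_mem_subCarrier_iff (L : Link) {I : Set (Fin L.numComp)} {i : Fin L.numComp}
    {t : ℝ} : L.param i t ∈ L.subCarrier I ↔ i ∈ I := by
  constructor
  · rintro ⟨j, hj, s, h⟩
    rwa [← (L.injective _ _ _ _ h).1]
  · exact fun h => ⟨i, h, t, rfl⟩

theorem mem_subCarrier_compl (L : Link) {I : Set (Fin L.numComp)} {p : E3} (hp : p ∈ L.carrier) :
    p ∈ L.subCarrier Iᶜ ↔ p ∉ L.subCarrier I := by
  obtain ⟨i, t, rfl⟩ := hp
  rw [param_mem_subCarrier_iff, param_mem_subCarrier_iff, Set.mem_compl_iff]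

end Link

namespace LinkDiagram

/-- If the projections of two nonempty sublinks are disjoint, the diagram has a coloring by two
colors. -/
theorem exists_two_coloring (D : LinkDiagram) {I : Set (Fin D.numComp)}
    (hI : I.Nonempty) (hI' : Iᶜ.Nonempty)
    (h : ∀ i ∈ I, ∀ j ∉ I, ∀ s t, planeProj (D.param i s) ≠ planeProj (D.param j t)) :
    ∃ γ : D.Arc → ℤ, D.IsZColoring γ ∧ ¬ D.IsTrivialColoring γ ∧ Set.range γ = {0, 1} := by
  classical
  have hout : ∀ (A : D.Arc) p, p ∈ A.1 → p ∈ D.subCarrier I → ∀ q ∈ A.1, q ∈ D.subCarrier I := by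
    intro A p hp hpI q hq
    by_contra hqI
    -- The two sublinks are disjoint closed sets, so a connected arc cannot meet both.
    have hsub : A.1 ⊆ D.subCarrier I ∪ D.subCarrier Iᶜ := by
      intro r hr
      by_cases hrI : r ∈ D.subCarrier I
      · exact Or.inl hrI
      · exact Or.inr ((D.mem_subCarrier_compl (A.subset_cutCarrier hr).1).2 hrI)
    obtain ⟨r, hr, hr1, hr2⟩ := isPreconnected_closed_iff.1 A.isPreconnected _ _
      (D.isCompact_subCarrier I).isClosed (D.isCompact_subCarrier Iᶜ).isClosed hsub
      ⟨p, hp, hpI⟩ ⟨q, hq, (D.mem_subCarrier_compl (A.subset_cutCarrier hq).1).2 hqI⟩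
    exact (D.mem_subCarrier_compl (A.subset_cutCarrier hr).1).1 hr2 hr1
  let γ : D.Arc → ℤ := fun A => if ∃ p ∈ A.1, p ∈ D.subCarrier I then 1 else 0
  have hmem : ∀ (A : D.Arc) p, p ∈ A.1 → γ A = if p ∈ D.subCarrier I then 1 else 0 := by
    intro A p hp
    have : (∃ p ∈ A.1, p ∈ D.subCarrier I) ↔ p ∈ D.subCarrier I :=
      ⟨fun ⟨q, hq, hqI⟩ => hout A q hq hqI p hp, fun hpI => ⟨p, hp, hpI⟩⟩
    simp only [γ, this]
  have hcomp : ∀ (A : D.Arc) i t, D.param i t ∈ A.1 → γ A = if i ∈ I then 1 else 0 := by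
    intro A i t hA
    rw [hmem A _ hA]
    simp only [Link.param_mem_subCarrier_iff]
  have hex : ∀ i, ∃ A : D.Arc, γ A = if i ∈ I then 1 else 0 := by
    intro i
    obtain ⟨u, hu⟩ := (D.eventually_mem_cutCarrier i 0).exists
    exact ⟨_, hcomp _ i u (D.mem_arcOf hu)⟩
  have h1 : ∃ A, γ A = 1 := by
    obtain ⟨i, hi⟩ := hI
    simpa [hi] using hex i
  have h0 : ∃ A, γ A = 0 := by
    obtain ⟨i, hi⟩ := hI'
    have hi : i ∉ I := hi
    simpa [hi] using hex i
  refine ⟨γ, ?_, ?_, ?_⟩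
  · rintro a b c ⟨p, i, t, hx, hpa, hb, hc⟩
    obtain ⟨u, hu⟩ := hb.exists
    obtain ⟨u', hu'⟩ := hc.exists
    obtain ⟨j, s, rfl⟩ := hx.1
    rw [hcomp b i u hu, hcomp c i u' hu', hcomp a j s hpa]
    -- No crossing involves both sublinks, so all three arcs have the same color.
    have : j ∈ I ↔ i ∈ I := by
      by_contra hne
      rw [not_iff] at hne
      by_cases hj : j ∈ I
      · exact h j hj i (fun hi => hne.2 hi hj) s t hx.2.2.1
      · exact h i (hne.1 hj) j hj t s hx.2.2.1.symm
    simp only [this]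
    ring
  · rintro ⟨m, hm⟩
    obtain ⟨A, hA⟩ := h1
    obtain ⟨B, hB⟩ := h0
    rw [hm] at hA hB
    omega
  · ext m
    constructor
    · rintro ⟨A, rfl⟩
      by_cases hA : ∃ p ∈ A.1, p ∈ D.subCarrier I
      · exact Or.inr (if_pos hA)
      · exact Or.inl (if_neg hA)
    · rintro (rfl | rfl)
      · exact h0
      · exact h1

/-- If a sublink lies above the remaining components, the diagram is equivalent to one in which
the projections of the two sublinks are disjoint. -/
theorem exists_separated (D : LinkDiagram) {I : Set (Fin D.numComp)}
    (hI : I.Nonempty) (hI' : Iᶜ.Nonempty)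
    (h : ∀ i ∈ I, ∀ j ∉ I, ∀ s t, planeProj (D.param j t) = planeProj (D.param i s) →
      D.param j t 2 < D.param i s 2) :
    ∃ (D' : LinkDiagram) (I' : Set (Fin D'.numComp)), D.toLink.Equivalent D'.toLink ∧
      I'.Nonempty ∧ I'ᶜ.Nonempty ∧ ∀ i ∈ I', ∀ j ∉ I', ∀ s t,
        planeProj (D'.param i s) ≠ planeProj (D'.param j t) := by
  obtain ⟨s, c, w, hs, hc, hR, hT, hRT⟩ := exists_doubleShear_separating
    (D.isCompact_subCarrier Iᶜ) (D.isCompact_subCarrier I) (by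
      rintro _ ⟨j, hj, t, rfl⟩ _ ⟨i, hi, u, rfl⟩ e
      exact h i hi j hj u t e)
  set F := doubleShear s c with hF
  have hFinj : Function.Injective F :=
    Function.LeftInverse.injective (doubleShearInv_doubleShear s c)
  have hFsmooth : ContDiff ℝ ∞ F := by
    have h1 := (contDiff_doubleShear_smul hs hc).comp
      (contDiff_prodMk_right (𝕜 := ℝ) (n := ∞) (F := E3) (1 : ℝ))
    simpa [Function.comp_def] using h1
  -- The projection of each component is only translated, which preserves its tangent vectors and
  -- thus immersion and transversality.
  have hcases : ∀ i, ∃ v, ∀ t, planeProj (F (D.param i t)) = planeProj (D.param i t) + v := by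
    intro i
    by_cases hi : i ∈ I
    · exact ⟨w, fun t => hT _ ⟨i, hi, t, rfl⟩⟩
    · exact ⟨0, fun t => by rw [add_zero]; exact hR _ ⟨i, hi, t, rfl⟩⟩
  have hsep : ∀ i ∈ I, ∀ j ∉ I, ∀ t u,
      planeProj (F (D.param i t)) ≠ planeProj (F (D.param j u)) := fun i hi j hj t u e =>
    hRT _ ⟨j, hj, u, rfl⟩ _ ⟨i, hi, t, rfl⟩ e.symm
  -- No new coincidences arise: the two points lie in the same sublink, hence were moved by the same
  -- translation.
  have hsame : ∀ i j t u, planeProj (F (D.param i t)) = planeProj (F (D.param j u)) →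
      (i ∈ I ↔ j ∈ I) ∧ planeProj (D.param i t) = planeProj (D.param j u) := by
    intro i j t u e
    by_cases hi : i ∈ I <;> by_cases hj : j ∈ I
    · refine ⟨iff_of_true hi hj, ?_⟩
      rw [hT _ ⟨i, hi, t, rfl⟩, hT _ ⟨j, hj, u, rfl⟩] at e
      exact add_right_cancel e
    · exact (hsep i hi j hj t u e).elim
    · exact (hsep j hj i hi u t e.symm).elim
    · refine ⟨iff_of_false hi hj, ?_⟩
      rwa [hR _ ⟨i, hi, t, rfl⟩, hR _ ⟨j, hj, u, rfl⟩] at e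
  have hsmooth : ∀ i, ContDiff ℝ ∞ fun t => F (D.param i t) := fun i =>
    hFsmooth.comp (D.smooth i)
  have hderiv : ∀ i t, planeProj (deriv (fun t => F (D.param i t)) t) =
      planeProj (deriv (D.param i) t) := by
    intro i t
    obtain ⟨v, hv⟩ := hcases i
    rw [planeProj_deriv ((hsmooth i).differentiable (by simp)).differentiableAt,
      planeProj_deriv ((D.smooth i).differentiable (by simp)).differentiableAt]
    simp only [hv, deriv_add_const]
  have himm : ∀ i t, planeProj (deriv (fun t => F (D.param i t)) t) ≠ 0 := fun i t => by
    rw [hderiv]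
    exact D.proj_immersion i t
  let L' : Link :=
    { numComp := D.numComp
      numComp_pos := D.numComp_pos
      param := fun i t => F (D.param i t)
      smooth := hsmooth
      periodic := fun i t => congrArg F (D.periodic i t)
      immersion := fun i t h0 => himm i t (by
        rw [h0]
        exact planeProjL.map_zero)
      injective := fun i j t u e => D.injective i j t u (hFinj e) }
  have hcarrier : F '' D.carrier = L'.carrier := by
    ext p
    constructor
    · rintro ⟨_, ⟨i, t, rfl⟩, rfl⟩
      exact ⟨i, t, rfl⟩
    · rintro ⟨i, t, rfl⟩
      exact ⟨_, ⟨i, t, rfl⟩, rfl⟩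
  let D' : LinkDiagram :=
    { toLink := L'
      proj_immersion := himm
      finite_multiple_points := by
        have hfin := D.finite_multiple_points
        refine (hfin.union (hfin.image (· + w))).subset ?_
        -- Each multiple point is an old one or the translate of an old one by `w`.
        rintro z ⟨_, _, ⟨i, t, rfl⟩, ⟨j, u, rfl⟩, hne, hi, hj⟩
        obtain ⟨hij, e⟩ := hsame i j t u (hi.trans hj.symm)
        have hm : planeProj (D.param i t) ∈ {z | ∃ p q : E3, p ∈ D.carrier ∧ q ∈ D.carrier ∧
            p ≠ q ∧ planeProj p = z ∧ planeProj q = z} :=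
          ⟨_, _, ⟨i, t, rfl⟩, ⟨j, u, rfl⟩, fun h0 => hne (congrArg F h0), rfl, e.symm⟩
        by_cases hiI : i ∈ I
        · exact Or.inr ⟨_, hm, (hT _ ⟨i, hiI, t, rfl⟩).symm.trans hi⟩
        · left
          rwa [← hR _ ⟨i, hiI, t, rfl⟩, show planeProj (F (D.param i t)) = z from hi] at hm
      no_triple_points := by
        rintro _ _ _ ⟨i, t, rfl⟩ ⟨j, u, rfl⟩ ⟨k, v, rfl⟩ e1 e2
        rcases D.no_triple_points _ _ _ (D.param_mem_carrier i t) (D.param_mem_carrier j u)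
          (D.param_mem_carrier k v) (hsame _ _ _ _ e1).2 (hsame _ _ _ _ e2).2 with e | e | e
        · exact Or.inl (congrArg F e)
        · exact Or.inr (Or.inl (congrArg F e))
        · exact Or.inr (Or.inr (congrArg F e))
      transverse := by
        intro i j t u hne e
        have := D.transverse i j t u (fun h0 => hne (congrArg F h0)) (hsame _ _ _ _ e).2
        rw [← hderiv, ← hderiv] at this
        exact this }
  exact ⟨D', I, Link.equivalent_of_doubleShear hs hc hcarrier, hI, hI', hsep⟩

/-- If a color occurring in a nontrivial `ℤ`-coloring is not an end of a nontrivial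
three-term arithmetic progression of colors, the link has minimal coloring number at most two. -/
theorem mincolZ_le_two_of_color_isolated {L : Link} {D : LinkDiagram} (hD : L.HasDiagram D)
    {γ : D.Arc → ℤ} (hγ : D.IsZColoring γ) (hnt : ¬ D.IsTrivialColoring γ) {v : ℤ}
    (hvm : v ∈ Set.range γ) (hv : ∀ a b, 2 * γ a = v + γ b → γ b = v) : L.mincolZ ≤ 2 := by
  set I : Set (Fin D.numComp) := {i | ∀ t, ∀ A : D.Arc, D.param i t ∈ A.1 → γ A = v} with hI
  have hcompl : ∀ j ∉ I, ∀ t, ∀ A : D.Arc, D.param j t ∈ A.1 → γ A ≠ v := fun j hj =>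
    (D.color_const_on_component hγ hv j).resolve_left hj
  have hmemI : ∀ (A : D.Arc) i t, D.param i t ∈ A.1 → (γ A = v ↔ i ∈ I) := fun A i t hA =>
    ⟨fun e => by_contra fun hi => hcompl i hi t A hA e, fun hi => hi t A hA⟩
  have hex : ∀ A : D.Arc, ∃ i t, D.param i t ∈ A.1 := by
    intro A
    obtain ⟨p, hp⟩ := A.nonempty
    obtain ⟨i, t, rfl⟩ := (A.subset_cutCarrier hp).1
    exact ⟨i, t, hp⟩
  have habove : ∀ i ∈ I, ∀ j ∉ I, ∀ s t, planeProj (D.param j t) = planeProj (D.param i s) →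
      D.param j t 2 < D.param i s 2 := by
    intro i hi j hj s t e
    rcases lt_trichotomy (D.param j t 2) (D.param i s 2) with h | h | h
    · exact h
    · have := (D.injective _ _ _ _ (E3.ext_of_planeProj e h)).1
      exact (hj (this ▸ hi)).elim
    -- A strand of `j` over `i` would have color `v` by `color_over_eq`, but `j` avoids `v`.
    · have hx : D.IsCrossing (D.param j t) (D.param i s) :=
        ⟨D.param_mem_carrier j t, D.param_mem_carrier i s, e, h⟩
      exact (hcompl j hj t _ (D.mem_arcOf hx.over_mem_cutCarrier) (D.color_over_eq hγ hv hi hx)).elim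
  have hIne : I.Nonempty := by
    obtain ⟨A, hA⟩ := hvm
    obtain ⟨i, t, h⟩ := hex A
    exact ⟨i, (hmemI A i t h).1 hA⟩
  have hIne' : Iᶜ.Nonempty := by
    rw [Set.nonempty_compl]
    intro hall
    refine hnt ⟨v, fun A => ?_⟩
    obtain ⟨i, t, h⟩ := hex A
    exact (hmemI A i t h).2 (hall ▸ Set.mem_univ i)
  obtain ⟨D', I', hequiv, hne, hne', hsep⟩ := D.exists_separated hIne hIne' habove
  obtain ⟨γ', h1, h2, h3⟩ := D'.exists_two_coloring hne hne' hsep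
  refine sInf_le ⟨D', Link.Equivalent.trans hD hequiv, γ', h1, h2, ?_⟩
  rw [h3, Set.encard_pair zero_ne_one]

end LinkDiagram

/-! ### Four equally spaced colors and the conclusion -/

/-- If every element of a set of four integers is an end of a nontrivial three-term
arithmetic progression in the set, the set is an arithmetic progression. -/
theorem exists_eq_arithmetic_progression {S : Set ℤ} (hS : S.encard = 4)
    (h : ∀ v ∈ S, ∃ a ∈ S, ∃ b ∈ S, 2 * a = v + b ∧ b ≠ v) :
    ∃ m d : ℤ, d ≠ 0 ∧ S = {m, m + d, m + 2 * d, m + 3 * d} := by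
  have hfin : S.Finite := Set.finite_of_encard_eq_coe (k := 4) hS
  lift S to Finset ℤ using hfin
  have hcard : S.card = 4 := by
    rw [Set.encard_coe_eq_coe_finsetCard] at hS
    exact_mod_cast hS
  let f := S.orderEmbOfFin hcard
  have hr : ∀ x, x ∈ S ↔ x = f 0 ∨ x = f 1 ∨ x = f 2 ∨ x = f 3 := by
    intro x
    have : x ∈ Set.range f ↔ x ∈ (S : Set ℤ) := by rw [S.range_orderEmbOfFin hcard]
    rw [← Finset.mem_coe, ← this]
    simp [Fin.exists_fin_succ, eq_comm]
  have h01 : f 0 < f 1 := f.strictMono (by decide)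
  have h12 : f 1 < f 2 := f.strictMono (by decide)
  have h23 : f 2 < f 3 := f.strictMono (by decide)
  simp only [Finset.mem_coe, hr] at h
  -- Nothing in the set lies between `f 0` and `f 1`, so a progression with end `f 1` must go
  -- upwards, and only `f 1, f 2, f 3` is left. The case of `f 2` is symmetric.
  have e1 : 2 * f 2 = f 1 + f 3 := by
    obtain ⟨a, ha, b, hb, e, hne⟩ := h (f 1) (by simp)
    rcases ha with rfl | rfl | rfl | rfl <;> rcases hb with rfl | rfl | rfl | rfl <;> omega
  have e2 : 2 * f 1 = f 2 + f 0 := by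
    obtain ⟨a, ha, b, hb, e, hne⟩ := h (f 2) (by simp)
    rcases ha with rfl | rfl | rfl | rfl <;> rcases hb with rfl | rfl | rfl | rfl <;> omega
  refine ⟨f 0, f 1 - f 0, by omega, ?_⟩
  ext x
  simp only [Finset.mem_coe, hr, Set.mem_insert_iff, Set.mem_singleton_iff]
  rw [show f 0 + (f 1 - f 0) = f 1 by ring, show f 0 + 2 * (f 1 - f 0) = f 2 by omega,
    show f 0 + 3 * (f 1 - f 0) = f 3 by omega]

theorem theorem3p2 (L : Link) (hL : L.IsZColorable) (h : L.mincolZ = 4) :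
    ∃ D : LinkDiagram, L.HasDiagram D ∧
      ∃ γ : D.Arc → ℤ, D.IsZColoring γ ∧ Set.range γ = {0, 1, 2, 3} := by
  obtain ⟨D₀, hD₀, γ₀, h₀, h₀'⟩ := hL
  -- Colorability makes the set nonempty, so its infimum in `ℕ∞` is attained.
  obtain ⟨D, hD, γ, hγ, hnt, hcard⟩ := csInf_mem (s := {n : ℕ∞ | ∃ D : LinkDiagram,
    L.HasDiagram D ∧ ∃ γ : D.Arc → ℤ, D.IsZColoring γ ∧ ¬ D.IsTrivialColoring γ ∧
      (Set.range γ).encard = n}) ⟨_, D₀, hD₀, γ₀, h₀, h₀', rfl⟩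
  change _ = L.mincolZ at hcard
  rw [h] at hcard
  obtain ⟨m, d, hd, hrange⟩ := exists_eq_arithmetic_progression hcard (by
    intro v hvm
    by_contra! hno
    have h2 := LinkDiagram.mincolZ_le_two_of_color_isolated hD hγ hnt hvm
      fun a b e => hno _ ⟨a, rfl⟩ _ ⟨b, rfl⟩ e
    rw [h] at h2
    exact absurd h2 (by decide))
  have hform : ∀ A, ∃ k, γ A = m + k * d := by
    intro A
    have hA : γ A ∈ Set.range γ := ⟨A, rfl⟩
    rw [hrange] at hA
    rcases hA with e | e | e | e
    · exact ⟨0, by rw [e]; ring⟩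
    · exact ⟨1, by rw [e]; ring⟩
    · exact ⟨2, e⟩
    · exact ⟨3, e⟩
  choose δ hδ using hform
  refine ⟨D, hD, δ, fun a b c hx => ?_, ?_⟩
  · have e := hγ a b c hx
    rw [hδ, hδ, hδ] at e
    -- The offsets `m` cancel since both sides of the relation have total weight two; `d ≠ 0` can
    -- then be divided out.
    exact mul_right_cancel₀ hd (by linear_combination e)
  · have hinj : Function.Injective fun k : ℤ => m + k * d := fun k l e =>
      mul_right_cancel₀ hd (add_left_cancel e)
    apply hinj.image_injective
    rw [← Set.range_comp, show (fun k : ℤ => m + k * d) ∘ δ = γ from funext fun A => (hδ A).symm,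
      hrange]
    simp [Set.image_insert_eq]
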